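/- For a sequence $t=(t_n)_{n\ge 1}$ with letters in $\{1,2\}$, define finite words $w_0,w_1,w_2,\dots$ recursively: $w_0$ is the empty word and, for $n\ge 1$, $w_n=w_{n-1}\,t_n^{\ell_n}$, where $\ell_n$ is the $n$-th letter of the word $w_{n-1}t_n$ (which has length at least $n$). Each $w_n$ has length at least $n$ and is a prefix of $w_{n+1}$; the sequence $\mathcal{O}_t=(x_n)_{n\ge1}$ directed by $t$ is the limit of the words $w_n$. In other words, the $n$-th block of $\mathcal{O}_t$ has length $x_n$ and is filled with the letter $t_n$. Let $p\in\,]0,1[$ and let $\mathbb{T}=(T_n)_{n\ge 1}$ be a Markov chain over the alphabet $\{1,2\}$ with initial value $T_1=1$ and whose transition probability from $1$ to $2$, and from $2$ to $1$, is $p$. Let $\mathbb{X}=(X_n)_{n\ge1}=\mathcal{O}_{\mathbb{T}}$ be the random sequence directed by $\mathbb{T}$, and let $|X_1\dots X_n|_1$ denote the number of indices $i\in\{1,\dots,n\}$ with $X_i=1$. Then $$\lim_{n\to\infty}\frac{\mathbb{E}\big(|X_1\dots X_n|_1\big)}{n}=\frac12 .$$ -/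

import Mathlib

open MeasureTheory ProbabilityTheory Filter Topology

/-! Sequences indexed by the positive integers are represented by functions on `ℕ`, shifted by one:
`t 0, t 1, t 2, …` are the letters `t₁, t₂, t₃, …`. -/

/-- The finite word `w_n = O_{t₁…t_n}` written after `n` steps: at each step one appends the next
letter of `t` as a block whose length is the letter of the word itself whose position is the number
of the block (that letter is possibly the one just written). -/
def directedWord (t : ℕ → ℕ) : ℕ → List ℕ
  | 0 => []
  | n + 1 =>
    (directedWord t n ++ [t n]) ++
      List.replicate ((directedWord t n ++ [t n]).getD n 0 - 1) (t n)

/-- The infinite sequence `O_t` directed by `t`, the limit of the words `directedWord t n`: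
its letter with index `m` is read off the word `directedWord t (m + 1)`, which is long enough
(`le_length_directedWord`); any other long enough word gives the same letter
(`directedWord_getElem?`). -/
def directedSeq (t : ℕ → ℕ) (m : ℕ) : ℕ :=
  (directedWord t (m + 1)).getD m 0

theorem le_length_directedWord (t : ℕ → ℕ) (n : ℕ) : n ≤ (directedWord t n).length := by
  induction n with
  | zero => exact Nat.zero_le _
  | succ n ih =>
    simp only [directedWord, List.length_append, List.length_replicate, List.length_singleton]
    omega

theorem directedWord_prefix (t : ℕ → ℕ) {m n : ℕ} (h : m ≤ n) :
    directedWord t m <+: directedWord t n := by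
  induction n, h using Nat.le_induction with
  | base => exact List.prefix_refl _
  | succ n _ ih =>
    refine ih.trans ?_
    simp only [directedWord, List.append_assoc]
    exact List.prefix_append _ _

/-- `directedSeq t` is the limit of the words `directedWord t n`: each of them is a prefix of it. -/
theorem directedWord_getElem? (t : ℕ → ℕ) (n m : ℕ) (h : m < (directedWord t n).length) :
    (directedWord t n)[m]? = some (directedSeq t m) := by
  have h1 : m < (directedWord t (m + 1)).length := le_length_directedWord t (m + 1)
  have key : (directedWord t n)[m]? = (directedWord t (m + 1))[m]? := by
    rcases le_total n (m + 1) with hn | hn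
    · have := (directedWord_prefix t hn).getElem h
      rw [List.getElem?_eq_getElem h, List.getElem?_eq_getElem h1, this]
    · have := (directedWord_prefix t hn).getElem h1
      rw [List.getElem?_eq_getElem h, List.getElem?_eq_getElem h1, this]
  rw [key, directedSeq, List.getD_eq_getElem?_getD, List.getElem?_eq_getElem h1]
  rfl

/-- `|x₁ … x_n|_a`, the number of occurrences of the letter `a` among the first `n` letters
of the sequence `x`. -/
def letterCount (a : ℕ) (x : ℕ → ℕ) (n : ℕ) : ℕ :=
  ((Finset.range n).filter (fun i => x i = a)).card

/-- Under the probability measure `P`, the process `T` is a (time-homogeneous) Markov chain over the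
alphabet `A`, with initial value `x₀` and transition probabilities `Q`: conditionally on any past
trajectory `a 0, …, a n` of positive probability, the next letter is `b` with probability
`Q (a n) b`. -/
structure IsMarkovChain {Ω : Type*} [MeasurableSpace Ω] (P : Measure Ω) (A : Set ℕ) (x₀ : ℕ)
    (Q : ℕ → ℕ → ℝ) (T : ℕ → Ω → ℕ) : Prop where
  measurable : ∀ n, Measurable (T n)
  mem_alphabet : ∀ n ω, T n ω ∈ A
  initial : ∀ᵐ ω ∂P, T 0 ω = x₀
  transition : ∀ (n : ℕ) (a : ℕ → ℕ) (b : ℕ), b ∈ A →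
    P {ω | ∀ i ≤ n, T i ω = a i} ≠ 0 →
    (P[|{ω | ∀ i ≤ n, T i ω = a i}]).real {ω | T (n + 1) ω = b} = Q (a n) b

/-- The transition probabilities on a two-letter alphabet for which the letter changes with
probability `p` and stays the same with probability `1 - p`. -/
def flipTransition (p : ℝ) (a b : ℕ) : ℝ := if a = b then 1 - p else p

/-! Give the letter `1` the sign `1` and the letter `2` the sign `-1`. The number of letters `1`
among the first `n` letters is then `n / 2` plus half the sum of their signs, and in this sum the
`i`-th block contributes the sign of `T i` times the number of its letters among the first `n`.

The letter `2` almost surely occurs infinitely often, so the word written after `m` steps eventually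
has more than `m + L` letters, and the length of block `m + L` is then determined by
`T 0, …, T (m - 1)`. By the Markov property the sign of `T (m + L)` has conditional expectation
`(1 - 2 * p) ^ L` times the sign of `T m`. Letting first `m` and then `L` tend to infinity, the
expected signed contribution of block `m + L` tends to `0` uniformly in `n`, and Cesàro's lemma
concludes. -/

section DirectedWord

variable {t t' : ℕ → ℕ} {n j : ℕ}

theorem directedWord_congr (h : ∀ i < n, t i = t' i) : directedWord t n = directedWord t' n := by
  induction n with
  | zero => rfl
  | succ n ih =>
    rw [directedWord, directedWord, ih fun i hi => h i (hi.trans n.lt_succ_self),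
      h n n.lt_succ_self]

theorem mem_range_of_mem_directedWord {v : ℕ} (h : v ∈ directedWord t n) : v ∈ Set.range t := by
  induction n with
  | zero => simp [directedWord] at h
  | succ n ih =>
    simp only [directedWord, List.mem_append, List.mem_singleton, List.mem_replicate] at h
    obtain (h | rfl) | ⟨-, rfl⟩ := h
    · exact ih h
    all_goals exact Set.mem_range_self n

theorem directedSeq_mem_range (t : ℕ → ℕ) (n : ℕ) : directedSeq t n ∈ Set.range t :=
  mem_range_of_mem_directedWord <|
    List.mem_of_getElem? (directedWord_getElem? t (n + 1) n (le_length_directedWord t (n + 1)))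

theorem directedSeq_le {c : ℕ} (ht : ∀ i, t i ≤ c) (n : ℕ) : directedSeq t n ≤ c := by
  obtain ⟨i, hi⟩ := directedSeq_mem_range t n
  exact hi ▸ ht i

theorem directedSeq_eq_of_directedWord_eq (h : directedWord t n = directedWord t' n)
    (hj : j < (directedWord t n).length) : directedSeq t j = directedSeq t' j := by
  refine Option.some.inj ?_
  rw [← directedWord_getElem? t n j hj, ← directedWord_getElem? t' n j (h ▸ hj), h]

/- The maximum covers the letter `0`, for which the recursion still writes a block of one letter. -/
theorem directedWord_succ (t : ℕ → ℕ) (n : ℕ) :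
    directedWord t (n + 1) =
      directedWord t n ++ List.replicate (max (directedSeq t n) 1) (t n) := by
  have hn : n < (directedWord t n ++ [t n]).length := by
    simpa using le_length_directedWord t n
  have hx : (directedWord t n ++ [t n]).getD n 0 = directedSeq t n := by
    rw [directedSeq, directedWord, List.getD_append _ _ _ _ hn]
  rw [directedWord, hx, List.append_assoc, List.singleton_append, ← List.replicate_succ,
    Nat.sub_add_eq_max]

theorem length_directedWord_succ (t : ℕ → ℕ) (n : ℕ) :
    (directedWord t (n + 1)).length = (directedWord t n).length + max (directedSeq t n) 1 := by
  rw [directedWord_succ, List.length_append, List.length_replicate]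

theorem length_directedWord_mono (t : ℕ → ℕ) : Monotone fun n => (directedWord t n).length :=
  fun _ _ h => (directedWord_prefix t h).length_le

theorem directedSeq_eq_of_mem_block (h₁ : (directedWord t n).length ≤ j)
    (h₂ : j < (directedWord t (n + 1)).length) : directedSeq t j = t n := by
  have h := directedWord_getElem? t (n + 1) j h₂
  rw [length_directedWord_succ] at h₂
  rw [directedWord_succ, List.getElem?_append_right h₁, List.getElem?_replicate,
    if_pos (by lia)] at h
  exact (Option.some.inj h).symm

theorem length_directedWord_eq_of_le_length (h : directedWord t n = directedWord t' n)
    (hnj : n ≤ j) (hj : j ≤ (directedWord t n).length) :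
    (directedWord t j).length = (directedWord t' j).length := by
  induction j, hnj using Nat.le_induction with
  | base => rw [h]
  | succ j _ ih =>
    rw [length_directedWord_succ, length_directedWord_succ, ih (by lia),
      directedSeq_eq_of_directedWord_eq h hj]

theorem frequently_two_le_directedSeq (ht : ∃ᶠ k in atTop, 2 ≤ t k) :
    ∃ᶠ j in atTop, 2 ≤ directedSeq t j := by
  refine frequently_atTop.2 fun r => ?_
  obtain ⟨k, hrk, hk⟩ := frequently_atTop.1 ht r
  refine ⟨(directedWord t k).length, hrk.trans (le_length_directedWord t k), ?_⟩
  rwa [directedSeq_eq_of_mem_block le_rfl (by rw [length_directedWord_succ]; lia)]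

theorem eventually_add_le_length_directedWord (ht : ∃ᶠ k in atTop, 2 ≤ t k) (L : ℕ) :
    ∀ᶠ n in atTop, n + L ≤ (directedWord t n).length := by
  induction L with
  | zero => exact Eventually.of_forall (le_length_directedWord t)
  | succ L ih =>
    obtain ⟨j, hj, hL⟩ := ((frequently_two_le_directedSeq ht).and_eventually ih).exists
    filter_upwards [eventually_gt_atTop j] with n hn
    induction n, hn using Nat.le_induction with
    | base => rw [length_directedWord_succ]; lia
    | succ n _ ihn => rw [length_directedWord_succ]; lia

end DirectedWord

/-- The number of letters of the block with index `i` of `directedSeq t` that lie among the first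
`n` letters: this block occupies the positions from `(directedWord t i).length` up to
`(directedWord t (i + 1)).length`, excluded. -/
def truncatedBlockLength (n : ℕ) (t : ℕ → ℕ) (i : ℕ) : ℕ :=
  min (directedWord t (i + 1)).length n - min (directedWord t i).length n

section TruncatedBlockLength

variable {t : ℕ → ℕ}

theorem truncatedBlockLength_le {c : ℕ} (hc : 1 ≤ c) (ht : ∀ i, t i ≤ c) (n i : ℕ) :
    truncatedBlockLength n t i ≤ c := by
  have hx := directedSeq_le ht i
  rw [truncatedBlockLength, length_directedWord_succ]
  lia

theorem sum_range_min_length_directedWord {M : Type*} [AddCommMonoid M] (f : ℕ → M) (t : ℕ → ℕ)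
    (n k : ℕ) :
    ∑ j ∈ Finset.range (min (directedWord t k).length n), f (directedSeq t j) =
      ∑ i ∈ Finset.range k, truncatedBlockLength n t i • f (t i) := by
  induction k with
  | zero => simp [directedWord]
  | succ k ih =>
    have hle : min (directedWord t k).length n ≤ min (directedWord t (k + 1)).length n :=
      min_le_min_right n (length_directedWord_mono t k.le_succ)
    have hblock : ∀ j ∈ Finset.Ico (min (directedWord t k).length n)
        (min (directedWord t (k + 1)).length n), f (directedSeq t j) = f (t k) := by
      intro j hj
      rw [Finset.mem_Ico] at hj
      rw [directedSeq_eq_of_mem_block (n := k) (by lia) (by lia)]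
    rw [← Finset.sum_range_add_sum_Ico _ hle, ih, Finset.sum_congr rfl hblock,
      Finset.sum_const, Nat.card_Ico, Finset.sum_range_succ, truncatedBlockLength]

theorem sum_range_directedSeq {M : Type*} [AddCommMonoid M] (f : ℕ → M) (t : ℕ → ℕ) (n : ℕ) :
    ∑ j ∈ Finset.range n, f (directedSeq t j) =
      ∑ i ∈ Finset.range n, truncatedBlockLength n t i • f (t i) := by
  rw [← sum_range_min_length_directedWord, min_eq_right (le_length_directedWord t n)]

theorem dependsOn_directedWord (n : ℕ) : DependsOn (fun t => directedWord t n) (Set.Iio n) :=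
  fun _ _ h => directedWord_congr h

theorem dependsOn_truncatedBlockLength (n i : ℕ) :
    DependsOn (fun t => truncatedBlockLength n t i) (Set.Iic i) := by
  intro t t' h
  simp only [truncatedBlockLength, directedWord_congr fun j (hj : j < i + 1) => h j (by grind),
    directedWord_congr fun j (hj : j < i) => h j hj.le]

/- A word with more than `m + L` letters already contains the lengths of the blocks with indices up
to `m + L`: this is how far ahead the directed sequence can be predicted. -/
theorem dependsOn_truncatedBlockLength_of_lt_length (n m L : ℕ) :
    DependsOn (fun t => if m + L < (directedWord t m).length then
      truncatedBlockLength n t (m + L) else 0) (Set.Iio m) := by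
  intro t t' h
  have hw : directedWord t m = directedWord t' m := dependsOn_directedWord m h
  by_cases hlt : m + L < (directedWord t m).length
  · simp only [truncatedBlockLength, if_pos hlt, if_pos (hw ▸ hlt),
      length_directedWord_eq_of_le_length hw (by lia : m ≤ m + L) hlt.le,
      length_directedWord_eq_of_le_length hw (by lia : m ≤ m + L + 1) hlt]
  · simp only [if_neg hlt, if_neg (hw ▸ hlt)]

end TruncatedBlockLength

/-- The sign `1` of the letter `1`, and `-1` of the letter `2` (or of any other letter). -/
def letterSign (a : ℕ) : ℝ := if a = 1 then 1 else -1

theorem abs_letterSign (a : ℕ) : |letterSign a| = 1 := by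
  rw [letterSign]; split_ifs <;> norm_num

theorem letterCount_one_eq (x : ℕ → ℕ) (n : ℕ) :
    (letterCount 1 x n : ℝ) = (n + ∑ i ∈ Finset.range n, letterSign (x i)) / 2 := by
  have hsign : ∀ a, letterSign a = 2 * (if a = 1 then 1 else 0) - 1 := by
    intro a; rw [letterSign]; split_ifs <;> norm_num
  simp only [letterCount, hsign, Finset.sum_sub_distrib, ← Finset.mul_sum, Finset.sum_boole,
    Finset.sum_const, Finset.card_range, nsmul_eq_mul]
  ring

theorem measurable_comp_of_dependsOn {Ω ι X β : Type*} [MeasurableSpace Ω] [MeasurableSpace X]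
    [Countable X] [DiscreteMeasurableSpace X] [MeasurableSpace β] [Nonempty β] {T : ι → Ω → X}
    (hT : ∀ i, Measurable (T i)) {g : (ι → X) → β} {s : Set ι} [Finite s] (hg : DependsOn g s) :
    Measurable fun ω => g fun i => T i ω := by
  obtain ⟨h, rfl⟩ := dependsOn_iff_exists_comp.1 hg
  exact (Measurable.of_discrete (f := h)).comp (measurable_pi_lambda _ fun i => hT i)

theorem integral_eq_of_forall_setIntegral_fiber_eq {Ω ι E : Type*} [MeasurableSpace Ω]
    {μ : Measure Ω} [NormedAddCommGroup E] [NormedSpace ℝ E] [Countable ι] [MeasurableSpace ι]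
    [MeasurableSingletonClass ι] {X : Ω → ι} (hX : Measurable X) {f g : Ω → E}
    (hf : Integrable f μ) (hg : Integrable g μ)
    (h : ∀ a, ∫ ω in X ⁻¹' {a}, f ω ∂μ = ∫ ω in X ⁻¹' {a}, g ω ∂μ) :
    ∫ ω, f ω ∂μ = ∫ ω, g ω ∂μ := by
  have hmeas : ∀ a, MeasurableSet (X ⁻¹' {a}) := fun a => hX (measurableSet_singleton a)
  have hdisj : Pairwise (Function.onFun Disjoint fun a => X ⁻¹' {a}) := pairwise_disjoint_fiber X
  have hcover : ⋃ a, X ⁻¹' {a} = Set.univ := by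
    rw [← Set.preimage_iUnion, Set.iUnion_of_singleton, Set.preimage_univ]
  rw [← setIntegral_univ, ← setIntegral_univ (f := g), ← hcover,
    integral_iUnion hmeas hdisj hf.integrableOn, integral_iUnion hmeas hdisj hg.integrableOn]
  exact tsum_congr h

theorem tendsto_sum_range_div_of_tendstoUniformly {c : ℕ → ℕ → ℝ} {C : ℝ}
    (hC : ∀ i n, |c i n| ≤ C) (hc : TendstoUniformly c 0 atTop) :
    Tendsto (fun n : ℕ => (∑ i ∈ Finset.range n, c i n) / n) atTop (𝓝 0) := by
  have hbdd : ∀ i, BddAbove (Set.range fun n => |c i n|) := fun i =>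
    ⟨C, Set.forall_mem_range.2 (hC i)⟩
  have hsup : Tendsto (fun i => ⨆ n, |c i n|) atTop (𝓝 0) := by
    refine tendsto_order.2 ⟨fun a ha => ?_, fun ε hε => ?_⟩
    · exact Eventually.of_forall fun i => ha.trans_le (Real.iSup_nonneg fun n => abs_nonneg _)
    · filter_upwards [Metric.tendstoUniformly_iff.1 hc (ε / 2) (half_pos hε)] with i hi
      refine (ciSup_le fun n => ?_).trans_lt (half_lt_self hε)
      simpa using (hi n).le
  refine squeeze_zero_norm (fun n => ?_) hsup.cesaro
  rw [Real.norm_eq_abs, abs_div, Nat.abs_cast, div_eq_inv_mul]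
  gcongr
  exact (Finset.abs_sum_le_sum_abs _ _).trans (Finset.sum_le_sum fun i _ => le_ciSup (hbdd i) n)

namespace IsMarkovChain

variable {Ω : Type*} [MeasurableSpace Ω] {P : Measure Ω} {A : Set ℕ} {x₀ : ℕ} {Q : ℕ → ℕ → ℝ}
  {T : ℕ → Ω → ℕ}

theorem measurableSet_eq (hT : IsMarkovChain P A x₀ Q T) (n b : ℕ) :
    MeasurableSet {ω | T n ω = b} :=
  hT.measurable n (measurableSet_singleton b)

theorem measurableSet_forall_mem_eq (hT : IsMarkovChain P A x₀ Q T) (I : Set ℕ) (a : ℕ → ℕ) :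
    MeasurableSet {ω | ∀ i ∈ I, T i ω = a i} := by
  simp only [Set.ofPred_forall]
  exact MeasurableSet.biInter I.to_countable fun i _ => hT.measurableSet_eq i (a i)

theorem integrable_of_dependsOn [IsFiniteMeasure P] [Finite A] (hT : IsMarkovChain P A x₀ Q T)
    {g : (ℕ → ℕ) → ℝ} {s : Set ℕ} [Finite s] (hg : DependsOn g s) :
    Integrable (fun ω => g fun i => T i ω) P := by
  obtain ⟨h, rfl⟩ := dependsOn_iff_exists_comp.1 hg
  have hfin : {a : s → ℕ | ∀ i, a i ∈ A}.Finite := Set.Finite.pi' fun _ => A.toFinite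
  obtain ⟨C, hC⟩ := (hfin.image fun a => ‖h a‖).bddAbove
  refine Integrable.of_bound (measurable_comp_of_dependsOn hT.measurable hg).aestronglyMeasurable C
    (ae_of_all _ fun ω => hC (Set.mem_image_of_mem _ fun i => hT.mem_alphabet i ω))

theorem measureReal_past_inter [IsFiniteMeasure P] (hT : IsMarkovChain P A x₀ Q T) {b : ℕ}
    (hb : b ∈ A) (m : ℕ) (a : ℕ → ℕ) :
    P.real ({ω | ∀ i ≤ m, T i ω = a i} ∩ {ω | T (m + 1) ω = b}) =
      P.real {ω | ∀ i ≤ m, T i ω = a i} * Q (a m) b := by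
  have hmeas : MeasurableSet {ω | ∀ i ≤ m, T i ω = a i} :=
    hT.measurableSet_forall_mem_eq (Set.Iic m) a
  by_cases h0 : P {ω | ∀ i ≤ m, T i ω = a i} = 0
  · simp [measureReal_def, h0, measure_inter_null_of_null_left]
  · rw [← hT.transition m a b hb h0, mul_comm, measureReal_def,
      ← cond_mul_eq_inter hmeas, ENNReal.toReal_mul, measureReal_def, measureReal_def]

theorem setIntegral_next_eq [IsFiniteMeasure P] [Finite A] (hT : IsMarkovChain P A x₀ Q T)
    {b : ℕ} (hb : b ∈ A) {g : (ℕ → ℕ) → ℝ} {m : ℕ} (hg : DependsOn g (Set.Iic m)) :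
    ∫ ω in {ω | T (m + 1) ω = b}, g (fun i => T i ω) ∂P =
      ∫ ω, Q (T m ω) b * g (fun i => T i ω) ∂P := by
  have hQg : DependsOn (fun t => Q (t m) b * g t) (Set.Iic m) := fun t t' h => by
    simp only [h m Set.self_mem_Iic, hg h]
  have hpast : Measurable fun ω => (Set.Iic m).domRestrict fun i => T i ω :=
    measurable_pi_lambda _ fun i => hT.measurable i
  rw [← integral_indicator (hT.measurableSet_eq _ b)]
  refine integral_eq_of_forall_setIntegral_fiber_eq hpast
    ((hT.integrable_of_dependsOn hg).indicator (hT.measurableSet_eq _ b))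
    (hT.integrable_of_dependsOn hQg) fun a' => ?_
  obtain ⟨a, rfl⟩ : ∃ a : ℕ → ℕ, (Set.Iic m).domRestrict a = a' :=
    Subtype.val_injective.surjective_comp_right a'
  have hfiber : (fun ω => (Set.Iic m).domRestrict fun i => T i ω) ⁻¹'
      {(Set.Iic m).domRestrict a} = {ω | ∀ i ≤ m, T i ω = a i} := by
    ext ω; simp [funext_iff]
  have hmeas := hfiber ▸ hpast (measurableSet_singleton _)
  rw [hfiber, setIntegral_indicator (hT.measurableSet_eq _ b),
    setIntegral_congr_fun (hmeas.inter (hT.measurableSet_eq _ b)) fun ω hω => hg hω.1,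
    setIntegral_congr_fun hmeas fun ω hω => hQg hω]
  simp only [setIntegral_const, smul_eq_mul, hT.measureReal_past_inter hb, mul_assoc]

theorem measureReal_run_succ [IsFiniteMeasure P] [Finite A] (hT : IsMarkovChain P A x₀ Q T)
    {b : ℕ} (hb : b ∈ A) (r s : ℕ) :
    P.real {ω | ∀ i ∈ Set.Icc r (r + (s + 1)), T i ω = b} =
      Q b b * P.real {ω | ∀ i ∈ Set.Icc r (r + s), T i ω = b} := by
  classical
  set R := {ω | ∀ i ∈ Set.Icc r (r + s), T i ω = b}
  let g : (ℕ → ℕ) → ℝ := fun t => if ∀ i ∈ Set.Icc r (r + s), t i = b then 1 else 0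
  have hR : MeasurableSet R := hT.measurableSet_forall_mem_eq _ fun _ => b
  have hg : DependsOn g (Set.Iic (r + s)) := fun t t' h => by
    have hiff : (∀ i ∈ Set.Icc r (r + s), t i = b) ↔ ∀ i ∈ Set.Icc r (r + s), t' i = b :=
      forall₂_congr fun i hi => by rw [h i hi.2]
    simp only [g, hiff]
  have hgR : ∀ ω, g (fun i => T i ω) = R.indicator 1 ω := fun _ => rfl
  have hsucc : {ω | ∀ i ∈ Set.Icc r (r + (s + 1)), T i ω = b} =
      {ω | T (r + s + 1) ω = b} ∩ R := by
    ext ω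
    refine ⟨fun h => ⟨h _ ⟨by lia, le_rfl⟩, fun i hi => h i ⟨hi.1, by grind⟩⟩, fun h i hi => ?_⟩
    obtain hi' | rfl := Nat.le_succ_iff.1 hi.2
    exacts [h.2 i ⟨hi.1, hi'⟩, h.1]
  calc P.real {ω | ∀ i ∈ Set.Icc r (r + (s + 1)), T i ω = b}
    _ = ∫ ω in {ω | T (r + s + 1) ω = b}, g (fun i => T i ω) ∂P := by
      simp only [hsucc, hgR, setIntegral_indicator hR, Pi.one_apply, setIntegral_one_eq_measureReal]
    _ = ∫ ω, Q (T (r + s) ω) b * g (fun i => T i ω) ∂P := hT.setIntegral_next_eq hb hg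
    _ = ∫ ω, Q b b * R.indicator 1 ω ∂P := by
      refine integral_congr_ae (ae_of_all _ fun ω => ?_)
      by_cases hω : ω ∈ R
      · simp only [hgR, hω (r + s) ⟨r.le_add_right s, le_rfl⟩]
      · simp only [hgR, Set.indicator_of_notMem hω, mul_zero]
    _ = Q b b * P.real R := by rw [integral_const_mul, integral_indicator_one hR]

theorem ae_frequently_ne [IsFiniteMeasure P] [Finite A] (hT : IsMarkovChain P A x₀ Q T)
    {b : ℕ} (hb : b ∈ A) (hQ : Q b b ≠ 1) : ∀ᵐ ω ∂P, ∃ᶠ k in atTop, T k ω ≠ b := by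
  simp only [frequently_atTop, ae_all_iff]
  intro r
  let R : ℕ → Set Ω := fun s => {ω | ∀ i ∈ Set.Icc r (r + s), T i ω = b}
  have hRanti : Antitone R := fun s s' h ω hω i hi => hω i ⟨hi.1, hi.2.trans (by lia)⟩
  have hlim : Tendsto (fun s => P.real (R s)) atTop (𝓝 (P.real (⋂ s, R s))) :=
    (ENNReal.tendsto_toReal (measure_ne_top P _)).comp <|
      tendsto_measure_iInter_atTop
        (fun s => (hT.measurableSet_forall_mem_eq _ fun _ => b).nullMeasurableSet) hRanti
        ⟨0, measure_ne_top P _⟩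
  have hfix : P.real (⋂ s, R s) = Q b b * P.real (⋂ s, R s) := by
    refine tendsto_nhds_unique ((tendsto_add_atTop_iff_nat 1).2 hlim) ?_
    simpa only [R, hT.measureReal_run_succ hb] using hlim.const_mul (Q b b)
  have hnull : P (⋂ s, R s) = 0 := by
    rw [← measureReal_eq_zero_iff]
    by_contra h
    exact hQ (mul_right_cancel₀ h (by linarith))
  filter_upwards [measure_eq_zero_iff_ae_notMem.1 hnull] with ω hω
  by_contra! hrun
  exact hω (Set.mem_iInter.2 fun s i hi => hrun i hi.1)

section Flip

variable {p : ℝ}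

theorem integral_letterSign_succ_mul [IsFiniteMeasure P]
    (hT : IsMarkovChain P {1, 2} x₀ (flipTransition p) T)
    {g : (ℕ → ℕ) → ℝ} {m : ℕ} (hg : DependsOn g (Set.Iic m)) :
    ∫ ω, letterSign (T (m + 1) ω) * g (fun i => T i ω) ∂P =
      (1 - 2 * p) * ∫ ω, letterSign (T m ω) * g (fun i => T i ω) ∂P := by
  have hflip : ∀ a, 2 * flipTransition p a 1 - 1 = (1 - 2 * p) * letterSign a := by
    intro a; rw [flipTransition, letterSign]; split_ifs <;> ring
  have hflipg : DependsOn (fun t => flipTransition p (t m) 1 * g t) (Set.Iic m) :=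
    fun t t' h => by simp only [h m Set.self_mem_Iic, hg h]
  have hmeas := hT.measurableSet_eq (m + 1) 1
  have hint := hT.integrable_of_dependsOn hg
  calc ∫ ω, letterSign (T (m + 1) ω) * g (fun i => T i ω) ∂P
    _ = ∫ ω, (2 * {ω | T (m + 1) ω = 1}.indicator (fun ω => g fun i => T i ω) ω -
          g fun i => T i ω) ∂P := by
      refine integral_congr_ae (ae_of_all _ fun ω => ?_)
      simp only [letterSign, Set.indicator, Set.mem_ofPred_eq]
      split_ifs <;> ring
    _ = 2 * ∫ ω in {ω | T (m + 1) ω = 1}, g (fun i => T i ω) ∂P -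
          ∫ ω, g (fun i => T i ω) ∂P := by
      rw [integral_sub ((hint.indicator hmeas).const_mul 2) hint, integral_const_mul,
        integral_indicator hmeas]
    _ = ∫ ω, (2 * (flipTransition p (T m ω) 1 * g fun i => T i ω) - g fun i => T i ω) ∂P := by
      rw [hT.setIntegral_next_eq (by simp) hg, ← integral_const_mul,
        integral_sub ((hT.integrable_of_dependsOn hflipg).const_mul 2) hint]
    _ = (1 - 2 * p) * ∫ ω, letterSign (T m ω) * g (fun i => T i ω) ∂P := by
      rw [← integral_const_mul]
      refine integral_congr_ae (ae_of_all _ fun ω => ?_)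
      linear_combination (g fun i => T i ω) * hflip (T m ω)

theorem integral_letterSign_add_mul [IsFiniteMeasure P]
    (hT : IsMarkovChain P {1, 2} x₀ (flipTransition p) T)
    {g : (ℕ → ℕ) → ℝ} {m : ℕ} (hg : DependsOn g (Set.Iic m)) (L : ℕ) :
    ∫ ω, letterSign (T (m + L) ω) * g (fun i => T i ω) ∂P =
      (1 - 2 * p) ^ L * ∫ ω, letterSign (T m ω) * g (fun i => T i ω) ∂P := by
  induction L with
  | zero => simp
  | succ L ih =>
    have hg' : DependsOn g (Set.Iic (m + L)) := hg.mono (Set.Iic_subset_Iic.2 (m.le_add_right L))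
    rw [← add_assoc, hT.integral_letterSign_succ_mul hg', ih, pow_succ', mul_assoc]

theorem abs_integral_letterSign_add_mul_le [IsProbabilityMeasure P]
    (hT : IsMarkovChain P {1, 2} x₀ (flipTransition p) T)
    {g : (ℕ → ℕ) → ℝ} {m : ℕ} (hg : DependsOn g (Set.Iic m)) {C : ℝ}
    (hC : ∀ ω, |g fun i => T i ω| ≤ C) (L : ℕ) :
    |∫ ω, letterSign (T (m + L) ω) * g (fun i => T i ω) ∂P| ≤ |1 - 2 * p| ^ L * C := by
  rw [hT.integral_letterSign_add_mul hg, abs_mul, abs_pow]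
  gcongr
  simpa using norm_integral_le_of_norm_le_const (μ := P) (C := C)
    (f := fun ω => letterSign (T m ω) * g fun i => T i ω)
    (ae_of_all _ fun ω => by simpa [abs_mul, abs_letterSign] using hC ω)

end Flip

section LetterCount

theorem measurable_length_directedWord (hT : IsMarkovChain P A x₀ Q T) (m : ℕ) :
    Measurable fun ω => (directedWord (fun i => T i ω) m).length :=
  measurable_comp_of_dependsOn (g := fun t => (directedWord t m).length) hT.measurable
    fun _ _ h => congrArg List.length (dependsOn_directedWord m h)

theorem integrable_letterSign_mul_truncatedBlockLength [IsFiniteMeasure P] [Finite A]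
    (hT : IsMarkovChain P A x₀ Q T) (n i : ℕ) :
    Integrable (fun ω => letterSign (T i ω) * truncatedBlockLength n (fun j => T j ω) i) P :=
  hT.integrable_of_dependsOn (s := Set.Iic i)
    (g := fun t => letterSign (t i) * truncatedBlockLength n t i) fun t t' h => by
      simp only [h i Set.self_mem_Iic, dependsOn_truncatedBlockLength n i h]

theorem integral_letterCount_one [IsProbabilityMeasure P] [Finite A]
    (hT : IsMarkovChain P A x₀ Q T) (n : ℕ) :
    ∫ ω, (letterCount 1 (directedSeq fun i => T i ω) n : ℝ) ∂P =
      (n + ∑ i ∈ Finset.range n,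
        ∫ ω, letterSign (T i ω) * truncatedBlockLength n (fun j => T j ω) i ∂P) / 2 := by
  have hint := fun i (_ : i ∈ Finset.range n) =>
    hT.integrable_letterSign_mul_truncatedBlockLength n i
  simp only [letterCount_one_eq, sum_range_directedSeq, nsmul_eq_mul,
    mul_comm (Nat.cast _) (letterSign _)]
  rw [integral_div, integral_add (integrable_const _) (integrable_finsetSum _ hint),
    integral_finsetSum _ hint]
  simp

theorem truncatedBlockLength_le_two (hT : IsMarkovChain P {1, 2} x₀ Q T) (n i : ℕ) (ω : Ω) :
    truncatedBlockLength n (fun j => T j ω) i ≤ 2 :=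
  truncatedBlockLength_le one_le_two (fun j => by grind [hT.mem_alphabet j ω]) n i

variable {p : ℝ}

theorem tendsto_measureReal_length_directedWord_le [IsFiniteMeasure P] (hp0 : p ≠ 0)
    (hT : IsMarkovChain P {1, 2} x₀ (flipTransition p) T) (L : ℕ) :
    Tendsto (fun m => P.real {ω | (directedWord (fun i => T i ω) m).length ≤ m + L})
      atTop (𝓝 0) := by
  have hlong : ∀ᵐ ω ∂P,
      ∀ᶠ m in atTop, m + (L + 1) ≤ (directedWord (fun i => T i ω) m).length := by
    filter_upwards [hT.ae_frequently_ne (b := 1) (by simp) (by simpa [flipTransition])] with ω hω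
    refine eventually_add_le_length_directedWord (hω.mono fun k hk => ?_) (L + 1)
    grind [hT.mem_alphabet k ω]
  have hlim := tendsto_measure_of_ae_tendsto_indicator_of_isFiniteMeasure (μ := P) atTop
    MeasurableSet.empty
    (fun m =>
      measurableSet_le (hT.measurable_length_directedWord m) (measurable_const (a := m + L)))
    (hlong.mono fun ω hω => hω.mono fun m hm => by simpa using Nat.lt_of_succ_le hm)
  simpa [Function.comp_def, measureReal_def] using
    (ENNReal.tendsto_toReal (measure_ne_top P ∅)).comp hlim

theorem abs_integral_letterSign_mul_truncatedBlockLength_le_two [IsProbabilityMeasure P]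
    (hT : IsMarkovChain P {1, 2} x₀ Q T) (n i : ℕ) :
    |∫ ω, letterSign (T i ω) * truncatedBlockLength n (fun j => T j ω) i ∂P| ≤ 2 := by
  simpa using norm_integral_le_of_norm_le_const (μ := P) (C := 2)
    (f := fun ω => letterSign (T i ω) * truncatedBlockLength n (fun j => T j ω) i)
    (ae_of_all _ fun ω => by
      simpa [abs_mul, abs_letterSign] using hT.truncatedBlockLength_le_two n i ω)

theorem abs_integral_letterSign_mul_truncatedBlockLength_le [IsProbabilityMeasure P]
    (hT : IsMarkovChain P {1, 2} x₀ (flipTransition p) T) (n m L : ℕ) :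
    |∫ ω, letterSign (T (m + L) ω) * truncatedBlockLength n (fun j => T j ω) (m + L) ∂P| ≤
      |1 - 2 * p| ^ L * 2 +
        2 * P.real {ω | (directedWord (fun i => T i ω) m).length ≤ m + L} := by
  set S := {ω | (directedWord (fun i => T i ω) m).length ≤ m + L}
  have hS : MeasurableSet S :=
    measurableSet_le (hT.measurable_length_directedWord m) measurable_const
  let f : Ω → ℝ := fun ω =>
    letterSign (T (m + L) ω) * truncatedBlockLength n (fun j => T j ω) (m + L)
  let g : (ℕ → ℕ) → ℝ := fun t => ((if m + L < (directedWord t m).length then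
      truncatedBlockLength n t (m + L) else 0 : ℕ) : ℝ)
  have hg : DependsOn g (Set.Iic m) := fun t t' h => congrArg Nat.cast
    (dependsOn_truncatedBlockLength_of_lt_length n m L fun i hi => h i (Set.Iio_subset_Iic_self hi))
  have hf2 : ∀ ω, ‖f ω‖ ≤ 2 := fun ω => by
    simpa [f, abs_mul, abs_letterSign] using hT.truncatedBlockLength_le_two n (m + L) ω
  have hg2 : ∀ ω, |g fun i => T i ω| ≤ 2 := fun ω => by
    have := hT.truncatedBlockLength_le_two n (m + L) ω
    simp only [g, Nat.abs_cast]; norm_cast; grind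
  have hpredicted : ∫ ω in Sᶜ, f ω ∂P =
      ∫ ω, letterSign (T (m + L) ω) * g (fun i => T i ω) ∂P := by
    rw [← integral_indicator hS.compl]
    refine integral_congr_ae (ae_of_all _ fun ω => ?_)
    by_cases hω : (directedWord (fun i => T i ω) m).length ≤ m + L <;>
      simp [f, g, S, Set.indicator, hω]
  calc |∫ ω, f ω ∂P|
    _ = |∫ ω in Sᶜ, f ω ∂P + ∫ ω in S, f ω ∂P| := by
      rw [add_comm, integral_add_compl hS
        (hT.integrable_letterSign_mul_truncatedBlockLength n (m + L))]
    _ ≤ |1 - 2 * p| ^ L * 2 + 2 * P.real S := by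
      refine (abs_add_le _ _).trans (add_le_add ?_ ?_)
      · exact hpredicted ▸ hT.abs_integral_letterSign_add_mul_le hg hg2 L
      · exact norm_setIntegral_le_of_norm_le_const (measure_lt_top P S) fun ω _ => hf2 ω

theorem tendstoUniformly_integral_letterSign_mul_truncatedBlockLength [IsProbabilityMeasure P]
    (hp0 : 0 < p) (hp1 : p < 1) (hT : IsMarkovChain P {1, 2} x₀ (flipTransition p) T) :
    TendstoUniformly (fun i n =>
      ∫ ω, letterSign (T i ω) * truncatedBlockLength n (fun j => T j ω) i ∂P) 0 atTop := by
  refine Metric.tendstoUniformly_iff.2 fun ε hε => ?_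
  have hq : |1 - 2 * p| < 1 := abs_lt.2 ⟨by linarith, by linarith⟩
  obtain ⟨L, hL⟩ := exists_pow_lt_of_lt_one (by linarith : 0 < ε / 4) hq
  have hshort : ∀ᶠ m in atTop,
      P.real {ω | (directedWord (fun i => T i ω) m).length ≤ m + L} < ε / 4 :=
    (hT.tendsto_measureReal_length_directedWord_le hp0.ne' L).eventually_lt_const (by linarith)
  rw [← map_add_atTop_eq_nat L, eventually_map]
  filter_upwards [hshort] with m hm n
  rw [Pi.zero_apply, dist_zero_left, Real.norm_eq_abs]
  linarith [hT.abs_integral_letterSign_mul_truncatedBlockLength_le n m L]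

end LetterCount

end IsMarkovChain

theorem mainTheorem5_general {Ω : Type*} [MeasurableSpace Ω] (P : Measure Ω)
    [IsProbabilityMeasure P] (p : ℝ) (hp0 : 0 < p) (hp1 : p < 1) (x₀ : ℕ) (T : ℕ → Ω → ℕ)
    (hT : IsMarkovChain P {1, 2} x₀ (flipTransition p) T) :
    Tendsto (fun n : ℕ =>
        (∫ ω, (letterCount 1 (directedSeq (fun i => T i ω)) n : ℝ) ∂P) / (n : ℝ))
      atTop (𝓝 (1 / 2)) := by
  have hsign : Tendsto (fun n : ℕ => (∑ i ∈ Finset.range n,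
      ∫ ω, letterSign (T i ω) * truncatedBlockLength n (fun j => T j ω) i ∂P) / (n : ℝ))
      atTop (𝓝 0) :=
    tendsto_sum_range_div_of_tendstoUniformly
      (fun i n => hT.abs_integral_letterSign_mul_truncatedBlockLength_le_two n i)
      (hT.tendstoUniformly_integral_letterSign_mul_truncatedBlockLength hp0 hp1)
  have hlim := (hsign.const_add 1).div_const 2
  rw [add_zero] at hlim
  refine hlim.congr' ?_
  filter_upwards [eventually_ne_atTop 0] with n hn
  rw [hT.integral_letterCount_one]
  field_simp

theorem mainTheorem5 {Ω : Type*} [MeasurableSpace Ω] (P : Measure Ω) [IsProbabilityMeasure P]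
    (p : ℝ) (hp0 : 0 < p) (hp1 : p < 1) (T : ℕ → Ω → ℕ)
    (hT : IsMarkovChain P {1, 2} 1 (flipTransition p) T) :
    Tendsto (fun n : ℕ =>
        (∫ ω, (letterCount 1 (directedSeq (fun i => T i ω)) n : ℝ) ∂P) / (n : ℝ))
      atTop (𝓝 (1 / 2)) :=
  mainTheorem5_general P p hp0 hp1 1 T hT
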